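/- Let $G$ be a finite group with unit $e$ and $H$ a normal subgroup of $G$. Let $\mathcal F_{H,\mathrm{loc}}$ be the unital complex $*$-algebra generated by $\delta_g(x)=\delta_g(x)^*$ and $\rho_h(l)=\rho_{h^{-1}}(l)^*$ ($g\in G$, $h\in H$, $x\in\mathbb Z$, $l\in\mathbb Z+\tfrac12$) subject to $$\sum_{g\in G}\delta_g(x)=I=\rho_e(l),\quad \delta_{g_1}(x)\delta_{g_2}(x)=\delta_{g_1,g_2}\,\delta_{g_1}(x),\quad \rho_{h_1}(l)\rho_{h_2}(l)=\rho_{h_1h_2}(l),\quad \delta_{g_1}(x)\delta_{g_2}(x')=\delta_{g_2}(x')\delta_{g_1}(x),$$ $$\rho_h(l)\delta_g(x)=\begin{cases}\delta_{hg}(x)\rho_h(l), & l<x,\\ \delta_g(x)\rho_h(l), & l>x,\end{cases}\qquad \rho_{h_1}(l)\rho_{h_2}(l')=\rho_{h_2}(l')\rho_{h_2^{-1}h_1h_2}(l)\quad (l>l').$$ Let $\mathcal F_H$ be its $C^*$-completion, that is, the $C^*$-inductive limit of the finite-dimensional $C^*$-algebras generated by the $\delta_g(x),\rho_h(l)$ with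 $x,l$ in a finite set. Let $D(H;G)$ be the crossed product of $C(H)$ and $\mathbb CG$ with linear basis $(h,g)$, $h\in H$, $g\in G$. It acts on $\mathcal F_H$ by continuous linear maps with $$(h,g)\,\delta_f(x)=\delta_{h,e}\,\delta_{gf}(x),\qquad (h,g)\,\rho_t(l)=\delta_{h,\,gtg^{-1}}\,\rho_h(l),\qquad (h,g)\,I=\delta_{h,e}\,I,$$ $$(h,g)(F_1F_2)=\sum_{t\in H}(t,g)(F_1)\,(t^{-1}h,g)(F_2).$$ Put $z_H=\frac1{|G|}\sum_{g\in G}(e,g)$ and $\mathcal A_{(H,G)}=\{F\in\mathcal F_H: z_H(F)=F\}$. **Theorem 3.1.** The map $z_H$ is a conditional expectation from $\mathcal F_H$ onto $\mathcal A_{(H,G)}$: the latter is a unital $C^*$-subalgebra of $\mathcal F_H$ and the range of $z_H$, and $z_H$ is linear, positive and unital with $z_H(F_1FF_2)=F_1z_H(F)F_2$ for $F_1,F_2\in\mathcal A_{(H,G)}$, $F\in\mathcal F_H$. Moreover, for every $k\in\mathbb Z$, setting $$u_{x,y}=\sqrt{|G|}\;\delta_x(k)\,\rho_y(k+\tfrac12)\qquad(x\in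 G,\ y\in H),$$ the finite family $\{(u_{x,y},u_{x,y}^*)\}_{x\in G,\,y\in H}$ is a quasi-basis for $z_H$: for all $a\in\mathcal F_H$, $$\sum_{x\in G}\sum_{y\in H}u_{x,y}\,z_H(u_{x,y}^*a)=a=\sum_{x\in G}\sum_{y\in H}z_H(a\,u_{x,y})\,u_{x,y}^*.$$ -/

import Mathlib

noncomputable section

namespace GSpin

universe u

/-- The half-integers `ℤ + 1/2`. -/
def HalfInt : Type := {l : ℚ // ∃ n : ℤ, l = n + 1 / 2}

/-- The half-integer `k + 1/2`. -/
def half (k : ℤ) : HalfInt := ⟨k + 1 / 2, k, rfl⟩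

/-- Symbols `δ_g(x)`, `g ∈ G`, `x ∈ ℤ`, and `ρ_h(l)`, `h ∈ H`, `l ∈ ℤ + 1/2`. -/
inductive Gen {G : Type u} [Group G] (H : Subgroup G) : Type u
  | delta (g : G) (x : ℤ) : Gen H
  | rho (h : H) (l : HalfInt) : Gen H

/-- The defining relations, for two families `d`, `r` of elements of a ring. -/
structure Relations {G : Type u} [Group G] [Fintype G] (H : Subgroup G)
    {A : Type*} [Ring A] (d : G → ℤ → A) (r : H → HalfInt → A) : Prop where
  sum_d : ∀ x, ∑ g, d g x = 1
  r_one : ∀ l, r 1 l = 1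
  d_mul_self : ∀ g x, d g x * d g x = d g x
  d_mul_ne : ∀ g₁ g₂ x, g₁ ≠ g₂ → d g₁ x * d g₂ x = 0
  r_mul : ∀ h₁ h₂ l, r h₁ l * r h₂ l = r (h₁ * h₂) l
  d_comm : ∀ g₁ g₂ x x', d g₁ x * d g₂ x' = d g₂ x' * d g₁ x
  r_d_lt : ∀ h g (l : HalfInt) (x : ℤ), l.1 < x → r h l * d g x = d (h * g) x * r h l
  r_d_gt : ∀ h g (l : HalfInt) (x : ℤ), (x : ℚ) < l.1 → r h l * d g x = d g x * r h l
  r_r : ∀ h₁ h₂ (l l' : HalfInt), l'.1 < l.1 →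
    r h₁ l * r h₂ l' = r h₂ l' * r (h₂⁻¹ * h₁ * h₂) l

section LocalAlgebra

variable {G : Type u} [Group G] [Fintype G] (H : Subgroup G)

/-- The same defining relations, between elements of the free algebra on the symbols. -/
inductive Rel : FreeAlgebra ℂ (Gen H) → FreeAlgebra ℂ (Gen H) → Prop
  | sum_d (x : ℤ) : Rel (∑ g, FreeAlgebra.ι ℂ (Gen.delta g x)) 1
  | r_one (l : HalfInt) : Rel (FreeAlgebra.ι ℂ (Gen.rho 1 l)) 1
  | d_mul_self (g : G) (x : ℤ) :
      Rel (FreeAlgebra.ι ℂ (Gen.delta g x) * FreeAlgebra.ι ℂ (Gen.delta g x))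
        (FreeAlgebra.ι ℂ (Gen.delta g x))
  | d_mul_ne (g₁ g₂ : G) (x : ℤ) (h : g₁ ≠ g₂) :
      Rel (FreeAlgebra.ι ℂ (Gen.delta g₁ x) * FreeAlgebra.ι ℂ (Gen.delta g₂ x)) 0
  | r_mul (h₁ h₂ : H) (l : HalfInt) :
      Rel (FreeAlgebra.ι ℂ (Gen.rho h₁ l) * FreeAlgebra.ι ℂ (Gen.rho h₂ l))
        (FreeAlgebra.ι ℂ (Gen.rho (h₁ * h₂) l))
  | d_comm (g₁ g₂ : G) (x x' : ℤ) :
      Rel (FreeAlgebra.ι ℂ (Gen.delta g₁ x) * FreeAlgebra.ι ℂ (Gen.delta g₂ x'))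
        (FreeAlgebra.ι ℂ (Gen.delta g₂ x') * FreeAlgebra.ι ℂ (Gen.delta g₁ x))
  | r_d_lt (h : H) (g : G) (l : HalfInt) (x : ℤ) (hlx : l.1 < x) :
      Rel (FreeAlgebra.ι ℂ (Gen.rho h l) * FreeAlgebra.ι ℂ (Gen.delta g x))
        (FreeAlgebra.ι ℂ (Gen.delta (h * g) x) * FreeAlgebra.ι ℂ (Gen.rho h l))
  | r_d_gt (h : H) (g : G) (l : HalfInt) (x : ℤ) (hlx : (x : ℚ) < l.1) :
      Rel (FreeAlgebra.ι ℂ (Gen.rho h l) * FreeAlgebra.ι ℂ (Gen.delta g x))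
        (FreeAlgebra.ι ℂ (Gen.delta g x) * FreeAlgebra.ι ℂ (Gen.rho h l))
  | r_r (h₁ h₂ : H) (l l' : HalfInt) (hl : l'.1 < l.1) :
      Rel (FreeAlgebra.ι ℂ (Gen.rho h₁ l) * FreeAlgebra.ι ℂ (Gen.rho h₂ l'))
        (FreeAlgebra.ι ℂ (Gen.rho h₂ l') * FreeAlgebra.ι ℂ (Gen.rho (h₂⁻¹ * h₁ * h₂) l))

/-- The local field algebra `F_{H,loc}`: the unital complex algebra presented by the generators
`δ_g(x)`, `ρ_h(l)` and the defining relations. -/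
def LocalField : Type u := RingQuot (Rel H)

instance : Ring (LocalField H) := inferInstanceAs (Ring (RingQuot (Rel H)))

instance : Algebra ℂ (LocalField H) := inferInstanceAs (Algebra ℂ (RingQuot (Rel H)))

namespace LocalField

/-- The quotient map from the free algebra. -/
def mk : FreeAlgebra ℂ (Gen H) →ₐ[ℂ] LocalField H := RingQuot.mkAlgHom ℂ (Rel H)

variable {H}

/-- The generator `δ_g(x)`. -/
def delta (g : G) (x : ℤ) : LocalField H := mk H (FreeAlgebra.ι ℂ (Gen.delta g x))

/-- The generator `ρ_h(l)`. -/
def rho (h : H) (l : HalfInt) : LocalField H := mk H (FreeAlgebra.ι ℂ (Gen.rho h l))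

theorem mk_rel {a b : FreeAlgebra ℂ (Gen H)} (h : Rel H a b) : mk H a = mk H b :=
  RingQuot.mkAlgHom_rel ℂ h

theorem relations : Relations H (delta (H := H)) rho where
  sum_d x := by simpa [delta] using mk_rel (Rel.sum_d (H := H) x)
  r_one l := by simpa [rho] using mk_rel (Rel.r_one (H := H) l)
  d_mul_self g x := by simpa [delta] using mk_rel (Rel.d_mul_self (H := H) g x)
  d_mul_ne g₁ g₂ x h := by simpa [delta] using mk_rel (Rel.d_mul_ne (H := H) g₁ g₂ x h)
  r_mul h₁ h₂ l := by simpa [rho] using mk_rel (Rel.r_mul (H := H) h₁ h₂ l)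
  d_comm g₁ g₂ x x' := by simpa [delta] using mk_rel (Rel.d_comm (H := H) g₁ g₂ x x')
  r_d_lt h g l x hl := by simpa [delta, rho] using mk_rel (Rel.r_d_lt (H := H) h g l x hl)
  r_d_gt h g l x hl := by simpa [delta, rho] using mk_rel (Rel.r_d_gt (H := H) h g l x hl)
  r_r h₁ h₂ l l' hl := by simpa [rho] using mk_rel (Rel.r_r (H := H) h₁ h₂ l l' hl)

/-- The value of the lifted map on the generators. -/
def genMap {A : Type*} (d : G → ℤ → A) (r : H → HalfInt → A) : Gen H → A
  | Gen.delta g x => d g x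
  | Gen.rho h l => r h l

/-- The universal property of the presentation. -/
def lift {A : Type*} [Ring A] [Algebra ℂ A] (d : G → ℤ → A) (r : H → HalfInt → A)
    (h : Relations H d r) : LocalField H →ₐ[ℂ] A :=
  RingQuot.liftAlgHom ℂ ⟨FreeAlgebra.lift ℂ (genMap d r), by
    intro a b hab
    cases hab with
    | sum_d x => simpa [genMap] using h.sum_d x
    | r_one l => simpa [genMap] using h.r_one l
    | d_mul_self g x => simpa [genMap] using h.d_mul_self g x
    | d_mul_ne g₁ g₂ x hg => simpa [genMap] using h.d_mul_ne g₁ g₂ x hg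
    | r_mul h₁ h₂ l => simpa [genMap] using h.r_mul h₁ h₂ l
    | d_comm g₁ g₂ x x' => simpa [genMap] using h.d_comm g₁ g₂ x x'
    | r_d_lt t g l x hl => simpa [genMap] using h.r_d_lt t g l x hl
    | r_d_gt t g l x hl => simpa [genMap] using h.r_d_gt t g l x hl
    | r_r h₁ h₂ l l' hl => simpa [genMap] using h.r_r h₁ h₂ l l' hl⟩

@[simp] theorem lift_delta {A : Type*} [Ring A] [Algebra ℂ A] {d : G → ℤ → A}
    {r : H → HalfInt → A} (h : Relations H d r) (g : G) (x : ℤ) :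
    lift d r h (delta g x) = d g x := by
  refine (RingQuot.liftAlgHom_mkAlgHom_apply ℂ _ _ _).trans ?_
  simp [genMap]

@[simp] theorem lift_rho {A : Type*} [Ring A] [Algebra ℂ A] {d : G → ℤ → A}
    {r : H → HalfInt → A} (h : Relations H d r) (t : H) (l : HalfInt) :
    lift d r h (rho t l) = r t l := by
  refine (RingQuot.liftAlgHom_mkAlgHom_apply ℂ _ _ _).trans ?_
  simp [genMap]

theorem induction {P : LocalField H → Prop} (hs : ∀ c : ℂ, P (algebraMap ℂ _ c))
    (hd : ∀ g x, P (delta g x)) (hr : ∀ t l, P (rho t l))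
    (ha : ∀ a b, P a → P b → P (a + b)) (hm : ∀ a b, P a → P b → P (a * b))
    (a : LocalField H) : P a := by
  obtain ⟨a, rfl⟩ := RingQuot.mkAlgHom_surjective ℂ (Rel H) a
  change P (mk H a)
  induction a using FreeAlgebra.induction with
  | grade0 c => rw [AlgHom.commutes]; exact hs c
  | grade1 s => cases s with
    | delta g x => exact hd g x
    | rho t l => exact hr t l
  | mul a b iha ihb => rw [map_mul]; exact hm _ _ iha ihb
  | add a b iha ihb => rw [map_add]; exact ha _ _ iha ihb

/-! ### The `*`-operation -/

variable (H) in
/-- The opposite algebra of the local field algebra, with the conjugate scalar action; a linear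
multiplicative map into it is an antilinear antimultiplicative map. -/
def ConjOp : Type u := (LocalField H)ᵐᵒᵖ

instance : Ring (ConjOp H) := inferInstanceAs (Ring (LocalField H)ᵐᵒᵖ)

instance : Algebra ℂ (ConjOp H) :=
  Algebra.compHom (LocalField H)ᵐᵒᵖ (starRingEnd ℂ)

/-- The identity map to the conjugate opposite algebra. -/
def toConjOp (a : LocalField H) : ConjOp H := MulOpposite.op a

/-- The identity map from the conjugate opposite algebra. -/
def ofConjOp (a : ConjOp H) : LocalField H := MulOpposite.unop a

theorem relations_conjOp : Relations H (fun g x => toConjOp (delta (H := H) g x))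
    (fun h l => toConjOp (rho h⁻¹ l)) where
  sum_d x := (map_sum (MulOpposite.opAddEquiv (α := LocalField H)) (fun g => delta g x)
    Finset.univ).symm.trans (congrArg MulOpposite.op (relations.sum_d x))
  r_one l := congrArg MulOpposite.op (by simpa using relations.r_one (H := H) l)
  d_mul_self g x := congrArg MulOpposite.op (relations.d_mul_self g x)
  d_mul_ne g₁ g₂ x h := congrArg MulOpposite.op (relations.d_mul_ne g₂ g₁ x h.symm)
  r_mul h₁ h₂ l := congrArg MulOpposite.op
    ((relations.r_mul h₂⁻¹ h₁⁻¹ l).trans (by rw [mul_inv_rev]))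
  d_comm g₁ g₂ x x' := congrArg MulOpposite.op (relations.d_comm g₂ g₁ x' x)
  r_d_lt h g l x hl := congrArg MulOpposite.op
    (show delta g x * rho h⁻¹ l = rho h⁻¹ l * delta (h * g) x by
      simpa using (relations.r_d_lt h⁻¹ (h * g) l x hl).symm)
  r_d_gt h g l x hl := congrArg MulOpposite.op (relations.r_d_gt h⁻¹ g l x hl).symm
  r_r h₁ h₂ l l' hl := congrArg MulOpposite.op
    (show rho h₂⁻¹ l' * rho h₁⁻¹ l = rho (h₂⁻¹ * h₁ * h₂)⁻¹ l * rho h₂⁻¹ l' by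
      simpa [mul_assoc] using (relations.r_r (h₂⁻¹ * h₁⁻¹ * h₂) h₂⁻¹ l l' hl).symm)

/-- The `*`-operation as a map to the conjugate opposite algebra. -/
def starHom : LocalField H →ₐ[ℂ] ConjOp H := lift _ _ relations_conjOp

instance : Star (LocalField H) := ⟨fun a => ofConjOp (starHom a)⟩

theorem star_delta (g : G) (x : ℤ) : star (delta (H := H) g x) = delta g x :=
  congrArg ofConjOp (lift_delta relations_conjOp g x)

theorem star_rho (h : H) (l : HalfInt) : star (rho h l) = rho h⁻¹ l :=
  congrArg ofConjOp (lift_rho relations_conjOp h l)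

theorem star_mul' (a b : LocalField H) : star (a * b) = star b * star a :=
  congrArg ofConjOp (map_mul starHom a b)

theorem star_add' (a b : LocalField H) : star (a + b) = star a + star b :=
  congrArg ofConjOp (map_add starHom a b)

theorem star_smul' (c : ℂ) (a : LocalField H) : star (c • a) = star c • star a :=
  congrArg ofConjOp (map_smul starHom c a)

theorem star_algebraMap' (c : ℂ) :
    star (algebraMap ℂ (LocalField H) c) = algebraMap ℂ _ (star c) :=
  congrArg ofConjOp (AlgHom.commutes starHom c)

instance : StarRing (LocalField H) where
  star_involutive a := by
    induction a using induction with
    | hs c => rw [star_algebraMap', star_algebraMap', star_star]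
    | hd g x => rw [star_delta, star_delta]
    | hr t l => rw [star_rho, star_rho, inv_inv]
    | ha a b iha ihb => rw [star_add', star_add', iha, ihb]
    | hm a b iha ihb => rw [star_mul', star_mul', iha, ihb]
  star_mul := star_mul'
  star_add := star_add'

instance : StarModule ℂ (LocalField H) := ⟨star_smul'⟩

end LocalField

end LocalAlgebra

/-! ### The action of `D(H;G)` on the local field algebra -/

section Action

variable {G : Type u} [Group G] [Fintype G] {H : Subgroup G} [H.Normal]

namespace LocalField

open MonoidAlgebra in
theorem relations_coaction (g : G) : Relations H
    (fun f x => single (1 : H) (delta (H := H) (g * f) x))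
    (fun t l => single (MulAut.conjNormal g t : H) (rho (MulAut.conjNormal g t : H) l)) where
  sum_d x := by
    have h := map_sum (MonoidAlgebra.singleAddHom (R := LocalField H) (1 : H))
      (fun f => delta (H := H) (g * f) x) Finset.univ
    rw [Fintype.sum_equiv (Equiv.mulLeft g) (fun f => delta (H := H) (g * f) x)
      (fun f => delta f x) (fun _ => rfl), relations.sum_d] at h
    exact h.symm
  r_one l := by simp [relations.r_one, one_def]
  d_mul_self f x := by simp [single_mul_single, relations.d_mul_self]
  d_mul_ne f₁ f₂ x h := by
    simp [single_mul_single, relations.d_mul_ne (g * f₁) (g * f₂) x (by simpa using h)]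
  r_mul h₁ h₂ l := by simp [single_mul_single, relations.r_mul]
  d_comm f₁ f₂ x x' := by simp [single_mul_single, relations.d_comm (g * f₁) (g * f₂) x x']
  r_d_lt h f l x hl := by
    simp [single_mul_single, relations.r_d_lt _ _ l x hl, mul_assoc]
  r_d_gt h f l x hl := by simp [single_mul_single, relations.r_d_gt _ _ l x hl]
  r_r h₁ h₂ l l' hl := by simp [single_mul_single, relations.r_r _ _ l l' hl, mul_assoc]

/-- The algebra homomorphism `F ↦ ∑_h (h,g)(F) ⊗ h` into `F_{H,loc} ⊗ ℂH`, given on generators by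
`δ_f(x) ↦ δ_{gf}(x) ⊗ e` and `ρ_t(l) ↦ ρ_{gtg⁻¹}(l) ⊗ gtg⁻¹`. -/
def coaction (g : G) : LocalField H →ₐ[ℂ] MonoidAlgebra (LocalField H) H :=
  lift _ _ (relations_coaction g)

/-- The action of the basis element `(h,g)` of `D(H;G)` on the local field algebra. -/
def act (h : H) (g : G) : LocalField H →ₗ[ℂ] LocalField H where
  toFun a := (coaction g a).coeff h
  map_add' a b := by simp
  map_smul' c a := by simp

open Classical in
theorem act_delta (h : H) (g f : G) (x : ℤ) :
    act h g (delta f x) = if h = 1 then delta (g * f) x else 0 := by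
  simp [act, coaction, Finsupp.single_apply, eq_comm]

open Classical in
theorem act_rho (h t : H) (g : G) (l : HalfInt) :
    act h g (rho t l) = if (h : G) = g * t * g⁻¹ then rho h l else 0 := by
  by_cases hh : (h : G) = g * t * g⁻¹
  · obtain rfl : h = MulAut.conjNormal g t := Subtype.ext hh
    simp [act, coaction]
  · have : MulAut.conjNormal g t ≠ h := fun h' => hh (by rw [← h']; simp)
    simp [act, coaction, hh, this]

open Classical in
theorem act_algebraMap (h : H) (g : G) (c : ℂ) :
    act h g (algebraMap ℂ _ c) = if h = 1 then algebraMap ℂ _ c else 0 := by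
  simp [act, Finsupp.single_apply, eq_comm]

/-- `(h,g)(ab) = ∑_t (t,g)(a) (t⁻¹h,g)(b)`. -/
theorem act_mul [Fintype H] (h : H) (g : G) (a b : LocalField H) :
    act h g (a * b) = ∑ t : H, act t g a * act (t⁻¹ * h) g b := by
  simp only [act, LinearMap.coe_mk, AddHom.coe_mk, map_mul]
  rw [MonoidAlgebra.coeff_mul_apply_left, Finsupp.sum_fintype]
  simp

open Classical in
theorem act_act_aux (h₁ h₂ : H) (g₁ g₂ : G) (a : LocalField H) :
    act h₁ g₁ (act h₂ g₂ a) =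
      if h₁ = MulAut.conjNormal g₁ h₂ then act h₁ (g₁ * g₂) a else 0 := by
  let _ := Fintype.ofFinite H
  induction a using induction generalizing h₁ h₂ with
  | hs c =>
    by_cases h2 : h₂ = 1
    · subst h2
      by_cases h1 : h₁ = 1 <;> simp [act_algebraMap, h1]
    · have : h₁ = MulAut.conjNormal g₁ h₂ → h₁ ≠ 1 := by
        rintro rfl; simpa using h2
      simp only [act_algebraMap, h2, if_false, map_zero]
      split_ifs with h1 h3
      · exact absurd h3 (this h1)
      · rfl
      · rfl
  | hd f x =>
    by_cases h2 : h₂ = 1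
    · subst h2
      by_cases h1 : h₁ = 1 <;> simp [act_delta, h1, mul_assoc]
    · have : h₁ = MulAut.conjNormal g₁ h₂ → h₁ ≠ 1 := by
        rintro rfl; simpa using h2
      simp only [act_delta, h2, if_false, map_zero]
      split_ifs with h1 h3
      · exact absurd h3 (this h1)
      · rfl
      · rfl
  | hr t l =>
    have key : ∀ (s s' : H) (g : G), (s : G) = g * s' * g⁻¹ ↔ s = MulAut.conjNormal g s' := by
      intro s s' g
      rw [Subtype.ext_iff, MulAut.conjNormal_apply]
    simp only [act_rho, key, map_mul, MulAut.mul_apply]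
    by_cases h2 : h₂ = MulAut.conjNormal g₂ t
    · subst h2
      simp only [if_true, act_rho, key]
      split_ifs <;> rfl
    · have : h₁ = MulAut.conjNormal g₁ h₂ → h₁ ≠ MulAut.conjNormal g₁ (MulAut.conjNormal g₂ t) := by
        rintro rfl; simpa using h2
      simp only [h2, if_false, map_zero]
      split_ifs <;> simp_all
  | ha a b iha ihb => simp only [map_add, iha, ihb]; split_ifs <;> simp
  | hm a b iha ihb =>
    rw [act_mul, map_sum]
    simp only [act_mul, iha, ihb, ite_mul, zero_mul, Finset.sum_ite_eq', Finset.mem_univ, if_true,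
      map_mul, map_inv]
    by_cases h1 : h₁ = MulAut.conjNormal g₁ h₂
    · subst h1
      simp only [if_true]
      exact Fintype.sum_equiv (MulAut.conjNormal g₁ : H ≃* H).toEquiv _ _ (fun t => by simp)
    · simp [h1]

open Classical in
/-- `(h₁,g₁)((h₂,g₂)(a)) = ((h₁,g₁)(h₂,g₂))(a)`. -/
theorem act_act (h₁ h₂ : H) (g₁ g₂ : G) (a : LocalField H) :
    act h₁ g₁ (act h₂ g₂ a) =
      if (h₁ : G) * g₁ = g₁ * h₂ then act h₁ (g₁ * g₂) a else 0 := by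
  rw [act_act_aux]
  congr 1
  rw [Subtype.ext_iff, MulAut.conjNormal_apply, eq_mul_inv_iff_mul_eq]

/-- `(h,g)(a*) = (S((h,g)*)(a))*`, where `S((h,g)*) = (h⁻¹,g)`. -/
theorem act_star (h : H) (g : G) (a : LocalField H) :
    act h g (star a) = star (act h⁻¹ g a) := by
  classical
  let _ := Fintype.ofFinite H
  induction a using induction generalizing h with
  | hs c =>
    rw [star_algebraMap', act_algebraMap, act_algebraMap]
    split_ifs <;> simp_all [star_algebraMap']
  | hd f x =>
    rw [star_delta, act_delta, act_delta]
    split_ifs <;> simp_all [star_delta]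
  | hr t l =>
    have key : (h : G) = g * (t⁻¹ : H) * g⁻¹ ↔ ((h⁻¹ : H) : G) = g * t * g⁻¹ := by
      rw [← inv_inj]; simp [mul_assoc]
    rw [star_rho, act_rho, act_rho]
    simp only [key]
    split_ifs <;> simp [star_rho]
  | ha a b iha ihb => simp only [map_add, star_add, iha, ihb]
  | hm a b iha ihb =>
    rw [star_mul, act_mul, act_mul, star_sum]
    simp only [star_mul, iha, ihb]
    refine Fintype.sum_equiv (Equiv.mulLeft h⁻¹) _ _ ?_
    intro t
    simp

end LocalField
end Action

/-! ### The `C*`-norm and the field algebra -/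

section Norm

variable {G : Type u} [Group G] [Fintype G] {H : Subgroup G}

namespace LocalField

/-- The norms of the images of `a` under all unital `*`-homomorphisms to `C*`-algebras. -/
def repNorms (a : LocalField H) : Set ℝ :=
  {c | ∃ (B : Type u) (_ : CStarAlgebra B) (φ : LocalField H →⋆ₐ[ℂ] B), c = ‖φ a‖}

theorem zero_mem_repNorms (a : LocalField H) : 0 ∈ repNorms a := by
  refine ⟨PEmpty.{u + 1} → ℂ, inferInstance,
    { toFun := fun _ => 0, map_one' := Subsingleton.elim _ _, map_mul' := fun _ _ => by simp,
      map_zero' := rfl, map_add' := fun _ _ => by simp,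
      commutes' := fun _ => Subsingleton.elim _ _, map_star' := fun _ => by simp }, ?_⟩
  change 0 = ‖(0 : PEmpty.{u + 1} → ℂ)‖
  rw [norm_zero]

theorem bddAbove_repNorms (a : LocalField H) : BddAbove (repNorms a) := by
  suffices h : ∃ C : ℝ, 0 ≤ C ∧ ∀ (B : Type u) (_ : CStarAlgebra B) (φ : LocalField H →⋆ₐ[ℂ] B),
      ‖φ a‖ ≤ C by
    obtain ⟨C, -, hC⟩ := h
    exact ⟨C, by rintro _ ⟨B, _, φ, rfl⟩; exact hC B _ φ⟩
  have one : ∀ (B : Type u) (_ : CStarAlgebra B), ‖(1 : B)‖ ≤ 1 := by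
    intro B _
    have h := CStarRing.norm_star_mul_self (x := (1 : B))
    rw [star_one, one_mul] at h
    nlinarith [norm_nonneg (1 : B)]
  induction a using induction with
  | hs c =>
    refine ⟨‖c‖, norm_nonneg _, fun B _ φ => ?_⟩
    have : φ (algebraMap ℂ _ c) = algebraMap ℂ B c := AlgHomClass.commutes φ c
    rw [this, norm_algebraMap]
    exact mul_le_of_le_one_right (norm_nonneg _) (one B _)
  | hd g x =>
    refine ⟨1, zero_le_one, fun B _ φ => ?_⟩
    have h := CStarRing.norm_star_mul_self (x := φ (delta g x))
    rw [← map_star, star_delta, ← map_mul, relations.d_mul_self] at h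
    nlinarith [norm_nonneg (φ (delta g x))]
  | hr t l =>
    refine ⟨1, zero_le_one, fun B _ φ => ?_⟩
    have h := CStarRing.norm_star_mul_self (x := φ (rho t l))
    rw [← map_star, star_rho, ← map_mul, relations.r_mul, inv_mul_cancel, relations.r_one,
      map_one] at h
    nlinarith [norm_nonneg (φ (rho t l)), one B inferInstance]
  | ha a b iha ihb =>
    obtain ⟨C, hC, iha⟩ := iha
    obtain ⟨D, hD, ihb⟩ := ihb
    refine ⟨C + D, by positivity, fun B _ φ => ?_⟩
    rw [map_add]
    exact (norm_add_le _ _).trans (add_le_add (iha B _ φ) (ihb B _ φ))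
  | hm a b iha ihb =>
    obtain ⟨C, hC, iha⟩ := iha
    obtain ⟨D, hD, ihb⟩ := ihb
    refine ⟨C * D, by positivity, fun B _ φ => ?_⟩
    rw [map_mul]
    exact (norm_mul_le _ _).trans (mul_le_mul (iha B _ φ) (ihb B _ φ) (norm_nonneg _) hC)

/-- The `C*`-norm of the local field algebra. Every element lies in the subalgebra `F_H(Λ)`
generated by the `δ_g(x)`, `ρ_h(l)` with `x, l` in some finite `Λ`, which is a finite-dimensional
`C*`-algebra and so has only one `C*`-norm, the largest value of `‖φ a‖`. -/
def cnorm (a : LocalField H) : ℝ := sSup (repNorms a)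

theorem le_cnorm {B : Type u} [CStarAlgebra B] (φ : LocalField H →⋆ₐ[ℂ] B) (a : LocalField H) :
    ‖φ a‖ ≤ cnorm a :=
  le_csSup (bddAbove_repNorms a) ⟨B, _, φ, rfl⟩

theorem cnorm_le {a : LocalField H} {C : ℝ}
    (h : ∀ (B : Type u) (_ : CStarAlgebra B) (φ : LocalField H →⋆ₐ[ℂ] B), ‖φ a‖ ≤ C) :
    cnorm a ≤ C :=
  csSup_le ⟨0, zero_mem_repNorms a⟩ (by rintro _ ⟨B, _, φ, rfl⟩; exact h B _ φ)

theorem cnorm_nonneg (a : LocalField H) : 0 ≤ cnorm a :=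
  le_csSup (bddAbove_repNorms a) (zero_mem_repNorms a)

variable (H) in
/-- The `C*`-norm as a ring seminorm. -/
def cseminorm : RingSeminorm (LocalField H) where
  toFun := cnorm
  map_zero' := le_antisymm (cnorm_le fun B _ φ => by simp) (cnorm_nonneg _)
  add_le' a b := cnorm_le fun B _ φ => by
    rw [map_add]
    exact (norm_add_le _ _).trans (add_le_add (le_cnorm φ a) (le_cnorm φ b))
  neg' a := congrArg sSup (by simp [repNorms])
  mul_le' a b := cnorm_le fun B _ φ => by
    rw [map_mul]
    exact (norm_mul_le _ _).trans
      (mul_le_mul (le_cnorm φ a) (le_cnorm φ b) (norm_nonneg _) (cnorm_nonneg _))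

instance : SeminormedRing (LocalField H) := (cseminorm H).toSeminormedRing

theorem norm_eq (a : LocalField H) : ‖a‖ = cnorm a := rfl

instance : NormedAlgebra ℂ (LocalField H) where
  norm_smul_le c a := cnorm_le fun B _ φ => by
    rw [map_smul, norm_smul]
    exact mul_le_mul_of_nonneg_left (le_cnorm φ a) (norm_nonneg _)

instance : NormedStarGroup (LocalField H) where
  norm_star_le a := cnorm_le fun B _ φ => by
    rw [map_star, norm_star]
    exact le_cnorm φ a

theorem norm_star_mul_self (a : LocalField H) : ‖star a * a‖ = ‖a‖ * ‖a‖ := by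
  refine le_antisymm ((norm_mul_le _ _).trans (by rw [norm_star])) ?_
  have h : ‖a‖ ≤ √‖star a * a‖ := cnorm_le fun B _ φ => by
    refine Real.le_sqrt_of_sq_le ?_
    rw [sq, ← CStarRing.norm_star_mul_self, ← map_star, ← map_mul]
    exact le_cnorm φ _
  calc ‖a‖ * ‖a‖ ≤ √‖star a * a‖ * √‖star a * a‖ := by gcongr
    _ = _ := Real.mul_self_sqrt (norm_nonneg _)

/-- The action of `D(H;G)` is contractive on basis elements. -/
theorem norm_act_le [H.Normal] (h : H) (g : G) (a : LocalField H) : ‖act h g a‖ ≤ ‖a‖ := by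
  classical
  let _ := Fintype.ofFinite H
  refine cnorm_le fun B _ φ => ?_
  let _ : PartialOrder B := CStarAlgebra.spectralOrder B
  let _ : StarOrderedRing B := CStarAlgebra.spectralOrderedRing B
  let ψ : LocalField H →⋆ₐ[ℂ] CStarMatrix H H B :=
    { toFun := fun a => CStarMatrix.ofMatrix (fun s t => φ (act (s * t⁻¹) g a))
      map_one' := by
        ext s t
        have := act_algebraMap (H := H) (s * t⁻¹) g 1
        rw [map_one] at this
        change φ (act (s * t⁻¹) g 1) = _
        by_cases hst : s = t
        · subst hst
          rw [this, CStarMatrix.one_apply_eq]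
          simp
        · simp [this, CStarMatrix.one_apply_ne hst, mul_inv_eq_one, hst]
      map_mul' := fun a b => by
        ext s t
        change φ (act (s * t⁻¹) g (a * b)) =
          ∑ r, φ (act (s * r⁻¹) g a) * φ (act (r * t⁻¹) g b)
        rw [act_mul, map_sum]
        refine Fintype.sum_equiv ((Equiv.inv H).trans (Equiv.mulRight s)) _ _ fun r => ?_
        simp [mul_assoc]
      map_zero' := by
        ext s t
        change φ (act (s * t⁻¹) g 0) = 0
        rw [map_zero, map_zero]
      map_add' := fun a b => by
        ext s t
        change φ (act (s * t⁻¹) g (a + b)) = φ (act (s * t⁻¹) g a) + φ (act (s * t⁻¹) g b)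
        rw [map_add, map_add]
      commutes' := fun c => by
        ext s t
        change φ (act (s * t⁻¹) g _) = _
        rw [act_algebraMap, CStarMatrix.algebraMap_apply]
        simp only [mul_inv_eq_one]
        split_ifs
        · exact AlgHomClass.commutes φ c
        · exact map_zero φ
      map_star' := fun a => by
        ext s t
        rw [CStarMatrix.star_apply]
        change φ (act (s * t⁻¹) g (star a)) = star (φ (act (t * s⁻¹) g a))
        rw [act_star, map_star]
        simp }
  have h1 : ψ a h 1 = φ (act h g a) := by
    change φ (act (h * 1⁻¹) g a) = _
    simp
  rw [← h1]
  exact CStarMatrix.norm_entry_le_norm.trans (le_cnorm ψ a)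

end LocalField

variable (H) in
/-- The field algebra `F_H`: the completion of `F_{H,loc} = ⋃_n F_H(Λ_n)` in the `C*`-norm, that
is, the `C*`-inductive limit of the local algebras. -/
def FieldAlgebra : Type u := UniformSpace.Completion (LocalField H)

namespace FieldAlgebra

open UniformSpace

instance : NormedRing (FieldAlgebra H) := inferInstanceAs (NormedRing (Completion (LocalField H)))

instance : CompleteSpace (FieldAlgebra H) :=
  inferInstanceAs (CompleteSpace (Completion (LocalField H)))

instance : Algebra ℂ (FieldAlgebra H) :=
  inferInstanceAs (Algebra ℂ (Completion (LocalField H)))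

instance : NormedAlgebra ℂ (FieldAlgebra H) where
  norm_smul_le := norm_smul_le (α := ℂ) (β := Completion (LocalField H))

instance : Star (FieldAlgebra H) :=
  ⟨Completion.map (star : LocalField H → LocalField H)⟩

variable (H) in
/-- The canonical map from the local field algebra to the field algebra. -/
def of : LocalField H →ₐ[ℂ] FieldAlgebra H where
  toFun a := (a : Completion (LocalField H))
  map_one' := Completion.coe_one _
  map_zero' := Completion.coe_zero
  map_mul' := Completion.coe_mul
  map_add' := Completion.coe_add
  commutes' _ := rfl

theorem norm_of (a : LocalField H) : ‖of H a‖ = ‖a‖ := Completion.norm_coe a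

theorem denseRange_of : DenseRange (of H) := Completion.denseRange_coe

theorem continuous_star : Continuous (star : FieldAlgebra H → FieldAlgebra H) :=
  Completion.continuous_map

theorem star_of (a : LocalField H) : star (of H a) = of H (star a) :=
  Completion.map_coe (f := (star : LocalField H → LocalField H))
    (starₗᵢ ℂ : LocalField H ≃ₗᵢ⋆[ℂ] LocalField H).isometry.uniformContinuous a

theorem induction {P : FieldAlgebra H → Prop} (hP : IsClosed {a | P a}) (h : ∀ a, P (of H a))
    (a : FieldAlgebra H) : P a := Completion.induction_on a hP h

theorem induction₂ {P : FieldAlgebra H → FieldAlgebra H → Prop}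
    (hP : IsClosed {p : FieldAlgebra H × FieldAlgebra H | P p.1 p.2})
    (h : ∀ a b, P (of H a) (of H b)) (a b : FieldAlgebra H) : P a b :=
  Completion.induction_on₂ a b hP h

instance : CStarAlgebra (FieldAlgebra H) where
  star_involutive a := by
    induction a using induction with
    | hP => exact isClosed_eq (continuous_star.comp continuous_star) continuous_id
    | h a => rw [star_of, star_of, star_star]
  star_mul a b := by
    induction a, b using induction₂ with
    | hP =>
      exact isClosed_eq (continuous_star.comp continuous_mul)
        ((continuous_star.comp continuous_snd).mul (continuous_star.comp continuous_fst))
    | h a b => rw [← map_mul, star_of, star_of, star_of, star_mul, map_mul]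
  star_add a b := by
    induction a, b using induction₂ with
    | hP =>
      exact isClosed_eq (continuous_star.comp continuous_add)
        ((continuous_star.comp continuous_fst).add (continuous_star.comp continuous_snd))
    | h a b => rw [← map_add, star_of, star_of, star_of, star_add, map_add]
  norm_mul_self_le a := by
    induction a using induction with
    | hP =>
      exact isClosed_le (by fun_prop) ((continuous_star.mul continuous_id).norm)
    | h a => rw [star_of, ← map_mul, norm_of, norm_of, LocalField.norm_star_mul_self]
  star_smul c a := by
    induction a using induction with
    | hP =>
      exact isClosed_eq (continuous_star.comp (continuous_const_smul c))
        (continuous_star.const_smul (star c))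
    | h a => rw [← map_smul, star_of, star_of, star_smul, map_smul]

end FieldAlgebra

end Norm

/-! ### The element `z_H`, the observable algebra -/

section Observables

variable {G : Type u} [Group G] [Fintype G] (H : Subgroup G)

/-- The underlying vector space of `D(H;G)`, with linear basis `(h,g)`, `h ∈ H`, `g ∈ G`. -/
abbrev Double : Type u := (H × G) →₀ ℂ

/-- The cointegral `z_H = |G|⁻¹ ∑_g (e,g)` of `D(H;G)`. -/
def cointegral : Double H := (Fintype.card G : ℂ)⁻¹ • ∑ g : G, Finsupp.single ((1 : H), g) 1

variable {H} [H.Normal]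

namespace FieldAlgebra

/-- The action of the basis element `(h,g)` on the field algebra: the continuous extension of its
action on the local field algebra. -/
def act (h : H) (g : G) : FieldAlgebra H →L[ℂ] FieldAlgebra H :=
  ContinuousLinearMap.completion
    ((LocalField.act h g).mkContinuous 1 fun a => by
      rw [one_mul]; exact LocalField.norm_act_le h g a)

theorem act_of (h : H) (g : G) (a : LocalField H) :
    act h g (of H a) = of H (LocalField.act h g a) :=
  ContinuousLinearMap.completion_apply_coe _ a

variable (H) in
/-- The action `γ` of `D(H;G)` on the field algebra. -/
def gamma : Double H →ₗ[ℂ] FieldAlgebra H →L[ℂ] FieldAlgebra H :=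
  Finsupp.linearCombination ℂ fun p : H × G => act p.1 p.2

variable (H) in
/-- The map `F ↦ z_H(F)` on the field algebra. -/
def zH : FieldAlgebra H →L[ℂ] FieldAlgebra H := gamma H (cointegral H)

theorem zH_apply (F : FieldAlgebra H) :
    zH H F = (Fintype.card G : ℂ)⁻¹ • ∑ g : G, act 1 g F := by
  simp [zH, gamma, cointegral]

theorem act_one_one (g : G) : act (1 : H) g 1 = 1 := by
  have := LocalField.act_algebraMap (H := H) 1 g 1
  simp only [map_one, if_true] at this
  rw [← map_one (of H), act_of, this]

theorem zH_algebraMap (c : ℂ) : zH H (algebraMap ℂ _ c) = algebraMap ℂ _ c := by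
  have hG : (Fintype.card G : ℂ) ≠ 0 := Nat.cast_ne_zero.mpr Fintype.card_ne_zero
  rw [Algebra.algebraMap_eq_smul_one, map_smul, zH_apply]
  simp only [act_one_one, Finset.sum_const, Finset.card_univ]
  rw [← Nat.cast_smul_eq_nsmul ℂ, inv_smul_smul₀ hG]

theorem zH_star (F : FieldAlgebra H) : zH H (star F) = star (zH H F) := by
  induction F using induction with
  | hP =>
    exact isClosed_eq ((zH H).continuous.comp continuous_star)
      (continuous_star.comp (zH H).continuous)
  | h a =>
    simp only [zH_apply, star_of, act_of, LocalField.act_star, ← map_sum, ← map_smul, star_smul,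
      star_sum, inv_one]
    simp

open Classical in
theorem act_act (h₁ h₂ : H) (g₁ g₂ : G) (F : FieldAlgebra H) :
    act h₁ g₁ (act h₂ g₂ F) = if (h₁ : G) * g₁ = g₁ * h₂ then act h₁ (g₁ * g₂) F else 0 := by
  induction F using induction with
  | hP => split_ifs <;> exact isClosed_eq (by fun_prop) (by fun_prop)
  | h a =>
    rw [act_of, act_of, LocalField.act_act, act_of]
    split_ifs <;> simp

open Classical in
theorem act_zH (h : H) (g : G) (F : FieldAlgebra H) :
    act h g (zH H F) = if h = 1 then zH H F else 0 := by
  simp only [zH_apply, map_smul, map_sum, act_act]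
  by_cases hh : h = 1
  · subst hh
    simp only [OneMemClass.coe_one, one_mul, mul_one, if_true]
    congr 1
    exact Fintype.sum_equiv (Equiv.mulLeft g) _ _ fun _ => rfl
  · have : (h : G) * g ≠ g * (1 : H) := by simpa using hh
    simp [hh]

theorem act_mul [Fintype H] (h : H) (g : G) (a b : FieldAlgebra H) :
    act h g (a * b) = ∑ t : H, act t g a * act (t⁻¹ * h) g b := by
  induction a, b using induction₂ with
  | hP => exact isClosed_eq (by fun_prop) (by fun_prop)
  | h a b =>
    rw [← map_mul, act_of, LocalField.act_mul, map_sum]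
    simp only [act_of, map_mul]

theorem zH_mul {a b : FieldAlgebra H} (ha : zH H a = a) (hb : zH H b = b) :
    zH H (a * b) = a * b := by
  classical
  let _ := Fintype.ofFinite H
  have hG : (Fintype.card G : ℂ) ≠ 0 := Nat.cast_ne_zero.mpr Fintype.card_ne_zero
  have key : ∀ g : G, act (1 : H) g (a * b) = a * b := by
    intro g
    rw [act_mul]
    conv_lhs => rw [← ha, ← hb]
    simp only [act_zH, mul_one, inv_eq_one]
    simp [ha, hb]
  rw [zH_apply]
  simp only [key, Finset.sum_const, Finset.card_univ]
  rw [← Nat.cast_smul_eq_nsmul ℂ, inv_smul_smul₀ hG]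

variable (H) in
/-- The observable algebra `A_{(H,G)} = {F ∈ F_H : z_H(F) = F}`. -/
def observables : StarSubalgebra ℂ (FieldAlgebra H) where
  carrier := {F | zH H F = F}
  mul_mem' := zH_mul
  add_mem' ha hb := (map_add _ _ _).trans (congrArg₂ _ ha hb)
  algebraMap_mem' := zH_algebraMap
  star_mem' {a} ha := (zH_star a).trans (congrArg star ha)

/-- The element `δ_g(x)` of the field algebra. -/
def delta (g : G) (x : ℤ) : FieldAlgebra H := of H (LocalField.delta g x)

/-- The element `ρ_h(l)` of the field algebra. -/
def rho (h : H) (l : HalfInt) : FieldAlgebra H := of H (LocalField.rho h l)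

end FieldAlgebra

end Observables

/-! ### Conditional expectations and quasi-bases -/

/-- `Γ` is a conditional expectation from the unital `C*`-algebra `B` onto its unital
`C*`-subalgebra `A`. Positive elements of `B` are those of the form `y* y`. -/
structure IsConditionalExpectation {B : Type*} [CStarAlgebra B] (A : StarSubalgebra ℂ B)
    (Γ : B →ₗ[ℂ] B) : Prop where
  isClosed : IsClosed (A : Set B)
  range_eq : Set.range Γ = (A : Set B)
  map_one : Γ 1 = 1
  bimodule : ∀ a ∈ A, ∀ b ∈ A, ∀ F : B, Γ (a * F * b) = a * Γ F * b
  positive : ∀ F : B, ∃ y : B, Γ (star F * F) = star y * y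

/-- The finite family `(u_i, u_i*)` is a quasi-basis for the conditional expectation `Γ` from `B`
onto `A`. -/
structure IsQuasiBasis {B : Type*} [CStarAlgebra B] (A : StarSubalgebra ℂ B) (Γ : B →ₗ[ℂ] B)
    {ι : Type*} [Fintype ι] (u : ι → B) : Prop where
  isConditionalExpectation : IsConditionalExpectation A Γ
  left : ∀ a : B, ∑ i, u i * Γ (star (u i) * a) = a
  right : ∀ a : B, ∑ i, Γ (a * u i) * star (u i) = a

end GSpin

end

noncomputable section

namespace GSpin

variable {G : Type*} [Group G] [Fintype G] {H : Subgroup G}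

/-! Conditional expectation: `zH` averages the operators `act 1 g` over `G`, and an element fixed by
it satisfies `act h g a = a` for `h = 1` and `0` otherwise (`act_zH`). In the product rule for `act
1 g (a * F)` only one term then survives, which lets fixed elements pass through `zH` on either
side. Positivity holds because the rule for the adjoint, `act_star`, turns `act 1 g (F* F)` into a
sum over `H` of elements `y* y`.

Quasi-basis: the two factors `√|G|` cancel the factor `|G|⁻¹` of `zH`, so the term of `(x, y)` in
the first identity is a sum over `g`. Pushing `act 1 g` through `ρ_{y⁻¹}` and `δ_x` produces
`δ_{gx}(k)`, and this commutes with every `ρ` at `k + 1/2`, because `k < k + 1/2`. It thus meets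
`δ_x(k)`, and orthogonality leaves only `g = e`. There the two `ρ` cancel, and the term is `δ_x(k)
(y,e)(a)` (`sum_delta_mul_rho_mul_act`). Summing over `y` gives `a`, since `∑_y (y,e)` is the unit
of `D(H;G)`; summing over `x` then uses `∑_x δ_x(k) = 1`. The second identity follows by taking
adjoints. -/

theorem coe_lt_half (k : ℤ) : (k : ℚ) < (half k).1 := by
  change (k : ℚ) < k + 1 / 2
  norm_num

/-- A finite sum of elements `y* y` of a `C*`-algebra is of this form. -/
theorem exists_sum_star_mul_self {B ι : Type*} [CStarAlgebra B] (s : Finset ι) (f : ι → B) :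
    ∃ y : B, ∑ i ∈ s, star (f i) * f i = star y * y := by
  -- In the spectral order the nonnegative elements are exactly the `y* y`, so closure under sums
  -- becomes additivity of nonnegativity.
  let _ : PartialOrder B := CStarAlgebra.spectralOrder B
  let _ : StarOrderedRing B := CStarAlgebra.spectralOrderedRing B
  exact CStarAlgebra.nonneg_iff_eq_star_mul_self.mp
    (Finset.sum_nonneg fun i _ => star_mul_self_nonneg (f i))

/-- A nonnegative real multiple of an element `y* y` of a `C*`-algebra is of this form. -/
theorem exists_smul_star_mul_self {B : Type*} [CStarAlgebra B] {c : ℝ} (hc : 0 ≤ c) (a : B) :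
    ∃ y : B, (c : ℂ) • (star a * a) = star y * y := by
  refine ⟨((√c : ℝ) : ℂ) • a, ?_⟩
  rw [star_smul, smul_mul_smul_comm, Complex.star_def, Complex.conj_ofReal, ← Complex.ofReal_mul,
    Real.mul_self_sqrt hc]

/-! ### The defining relations in the completed algebra -/

namespace FieldAlgebra

theorem sum_delta (x : ℤ) : ∑ g : G, delta (H := H) g x = 1 := by
  simp only [delta, ← map_sum, LocalField.relations.sum_d, map_one]

theorem delta_mul_self (g : G) (x : ℤ) : delta (H := H) g x * delta g x = delta g x := by
  simp only [delta, ← map_mul, LocalField.relations.d_mul_self]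

theorem delta_mul_ne {g₁ g₂ : G} (h : g₁ ≠ g₂) (x : ℤ) :
    delta (H := H) g₁ x * delta g₂ x = 0 := by
  simp only [delta, ← map_mul, LocalField.relations.d_mul_ne _ _ _ h, map_zero]

theorem rho_mul (h₁ h₂ : H) (l : HalfInt) : rho h₁ l * rho h₂ l = rho (h₁ * h₂) l := by
  simp only [rho, ← map_mul, LocalField.relations.r_mul]

theorem rho_one (l : HalfInt) : rho (1 : H) l = 1 := by
  simp only [rho, LocalField.relations.r_one, map_one]

theorem rho_mul_delta_of_gt (h : H) (g : G) {l : HalfInt} {x : ℤ} (hl : (x : ℚ) < l.1) :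
    rho h l * delta g x = delta g x * rho h l := by
  simp only [delta, rho, ← map_mul, LocalField.relations.r_d_gt _ _ _ _ hl]

theorem star_delta (g : G) (x : ℤ) : star (delta (H := H) g x) = delta g x := by
  rw [delta, star_of, LocalField.star_delta]

theorem star_rho (h : H) (l : HalfInt) : star (rho h l) = rho h⁻¹ l := by
  rw [rho, star_of, LocalField.star_rho, rho]

end FieldAlgebra

/-! ### The action of `D(H;G)` on adjoints and on products -/

variable [H.Normal]

/-- The sum of the `(h,e)` is the unit of `D(H;G)`. -/
theorem LocalField.sum_act_one [Fintype H] (a : LocalField H) :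
    ∑ h : H, LocalField.act h 1 a = a := by
  classical
  induction a using LocalField.induction with
  | hs c => simp [LocalField.act_algebraMap]
  | hd g x => simp [LocalField.act_delta]
  | hr t l => simp [LocalField.act_rho, SetLike.coe_eq_coe]
  | ha a b iha ihb => simp only [map_add, Finset.sum_add_distrib, iha, ihb]
  | hm a b iha ihb =>
    simp only [LocalField.act_mul]
    -- With the sum over `h` innermost, the translation `h ↦ t⁻¹ h` makes it independent of `t`, and
    -- the double sum factors.
    rw [Finset.sum_comm]
    simp only [← Finset.mul_sum]
    have (t : H) : ∑ h : H, LocalField.act (t⁻¹ * h) 1 b = b :=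
      (Fintype.sum_equiv (Equiv.mulLeft t⁻¹) _ (fun h => LocalField.act h 1 b)
        fun _ => rfl).trans ihb
    simp only [this, ← Finset.sum_mul, iha]

namespace FieldAlgebra

theorem sum_act_one [Fintype H] (a : FieldAlgebra H) : ∑ h : H, act h 1 a = a := by
  induction a using induction with
  | hP => exact isClosed_eq (by fun_prop) continuous_id
  | h a => simp only [act_of, ← map_sum, LocalField.sum_act_one]

theorem act_star (h : H) (g : G) (a : FieldAlgebra H) :
    act h g (star a) = star (act h⁻¹ g a) := by
  induction a using induction with
  | hP =>
    exact isClosed_eq ((act h g).continuous.comp continuous_star)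
      (continuous_star.comp (act h⁻¹ g).continuous)
  | h a => rw [star_of, act_of, act_of, LocalField.act_star, star_of]

/-- Since `(t,g)` kills `δ_f(x)` unless `t = e`, the product rule has a single nonzero term. -/
theorem act_delta_mul [Fintype H] (h : H) (g f : G) (x : ℤ) (a : FieldAlgebra H) :
    act h g (delta f x * a) = delta (g * f) x * act h g a := by
  classical
  rw [act_mul, Finset.sum_eq_single 1]
  · simp [delta, act_of, LocalField.act_delta]
  · intro t _ ht
    simp [delta, act_of, LocalField.act_delta, ht]
  · simp

/-- Only the component `gtg⁻¹` acts nontrivially on `ρ_t(l)`. The two `H`-components of a term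
multiply to `e`, which forces the inverse on the second factor. -/
theorem act_one_rho_mul [Fintype H] (g : G) (t : H) (l : HalfInt) (a : FieldAlgebra H) :
    act 1 g (rho t l * a) =
      rho (MulAut.conjNormal g t) l * act (MulAut.conjNormal g t)⁻¹ g a := by
  classical
  have key (s : H) : (s : G) = g * t * g⁻¹ ↔ s = MulAut.conjNormal g t := by
    rw [Subtype.ext_iff, MulAut.conjNormal_apply]
  rw [act_mul, Finset.sum_eq_single (MulAut.conjNormal g t)]
  · rw [rho, act_of, LocalField.act_rho, if_pos ((key _).2 rfl), mul_one, rho]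
  · intro s _ hs
    rw [rho, act_of, LocalField.act_rho, if_neg (mt (key s).1 hs), map_zero, zero_mul]
  · simp

/-! ### `z_H` as a conditional expectation -/

theorem act_one_mul_of_mem [Fintype H] {a : FieldAlgebra H} (ha : zH H a = a) (g : G)
    (F : FieldAlgebra H) : act 1 g (a * F) = a * act 1 g F := by
  classical
  rw [act_mul]
  -- Writing `a` as `zH H a` makes `act_zH` applicable; it kills every term of the product rule
  -- except `t = 1`.
  conv_lhs => rw [← ha]
  simp only [act_zH]
  simp [ha]

theorem act_one_mul_of_mem_right [Fintype H] {b : FieldAlgebra H} (hb : zH H b = b) (g : G)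
    (F : FieldAlgebra H) : act 1 g (F * b) = act 1 g F * b := by
  classical
  rw [act_mul]
  conv_lhs => rw [← hb]
  simp only [act_zH]
  simp [hb]

theorem zH_mul_mul_of_mem [Fintype H] {a b : FieldAlgebra H} (ha : zH H a = a) (hb : zH H b = b)
    (F : FieldAlgebra H) : zH H (a * F * b) = a * zH H F * b := by
  simp only [zH_apply, act_one_mul_of_mem_right hb, act_one_mul_of_mem ha, ← Finset.sum_mul,
    ← Finset.mul_sum, smul_mul_assoc, mul_smul_comm]

/-- Every `act 1 g` fixes `zH H F`, so averaging again changes nothing. This identifies the range of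
`zH` with its fixed points. -/
theorem zH_zH (F : FieldAlgebra H) : zH H (zH H F) = zH H F := by
  have hG : (Fintype.card G : ℂ) ≠ 0 := Nat.cast_ne_zero.mpr Fintype.card_ne_zero
  rw [zH_apply (zH H F)]
  simp only [act_zH, if_true, Finset.sum_const, Finset.card_univ]
  rw [← Nat.cast_smul_eq_nsmul ℂ, inv_smul_smul₀ hG]

theorem zH_star_mul_self [Fintype H] (F : FieldAlgebra H) :
    ∃ y : FieldAlgebra H, zH H (star F * F) = star y * y := by
  -- The inverse on `p.2` matches the product rule: `act t g (star F)` is the adjoint of `act t⁻¹ g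
  -- F`, and the factor beside it is `act t⁻¹ g F` itself.
  obtain ⟨y, hy⟩ := exists_sum_star_mul_self (Finset.univ : Finset (G × H))
    (fun p => act p.2⁻¹ p.1 F)
  obtain ⟨z, hz⟩ := exists_smul_star_mul_self (c := (Fintype.card G : ℝ)⁻¹) (by positivity) y
  refine ⟨z, ?_⟩
  rw [← hz, ← hy, zH_apply, Fintype.sum_prod_type]
  simp only [act_mul, act_star, mul_one]
  push_cast
  rfl

variable (H) in
theorem isConditionalExpectation_zH [Fintype H] :
    IsConditionalExpectation (observables H) (zH H : FieldAlgebra H →ₗ[ℂ] FieldAlgebra H) where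
  isClosed := isClosed_eq (zH H).continuous continuous_id
  range_eq := by
    ext F
    exact ⟨by rintro ⟨a, rfl⟩; exact zH_zH a, fun hF => ⟨F, hF⟩⟩
  map_one := by simpa using zH_algebraMap (H := H) 1
  bimodule _ ha _ hb F := zH_mul_mul_of_mem ha hb F
  positive F := zH_star_mul_self F

/-! ### The quasi-basis identities -/

/-- This form puts the two `δ` at site `k` side by side, so that orthogonality can select `g`. -/
theorem delta_mul_rho_mul_act [Fintype H] (k : ℤ) (x g : G) (y : H) (a : FieldAlgebra H) :
    delta x k * rho y (half k) * act 1 g (rho y⁻¹ (half k) * (delta x k * a)) =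
      delta x k * delta (g * x) k * (rho (y * MulAut.conjNormal g y⁻¹) (half k) *
        act (MulAut.conjNormal g y⁻¹)⁻¹ g a) := by
  rw [act_one_rho_mul, act_delta_mul, ← rho_mul]
  simp only [mul_assoc]
  -- `δ_{gx}(k)` moves left past the conjugated `ρ` here, and past `ρ_y` in the second such rewrite.
  rw [← mul_assoc (rho _ (half k)) (delta (g * x) k), rho_mul_delta_of_gt _ _ (coe_lt_half k)]
  simp only [mul_assoc]
  rw [← mul_assoc (rho _ (half k)) (delta (g * x) k), rho_mul_delta_of_gt _ _ (coe_lt_half k)]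
  simp only [mul_assoc]

theorem sum_delta_mul_rho_mul_act [Fintype H] (k : ℤ) (x : G) (y : H) (a : FieldAlgebra H) :
    ∑ g : G, delta x k * rho y (half k) * act 1 g (rho y⁻¹ (half k) * (delta x k * a)) =
      delta x k * act y 1 a := by
  simp only [delta_mul_rho_mul_act]
  rw [Finset.sum_eq_single 1]
  -- At `g = 1` the conjugation is trivial: the `ρ` factor is indexed by `y y⁻¹ = 1`, and the
  -- component of the action is `(y⁻¹)⁻¹ = y`.
  · simp [delta_mul_self, rho_one]
  · intro g _ hg
    -- For `g ≠ 1` one has `gx ≠ x`, so the two projections at site `k` are orthogonal.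
    rw [delta_mul_ne (fun h => hg (by simpa using h)), zero_mul]
  · simp

theorem sum_mul_zH_star_mul [Fintype H] (k : ℤ) (a : FieldAlgebra H) :
    ∑ p : G × H, ((√(Fintype.card G : ℝ) : ℝ) : ℂ) • (delta p.1 k * rho p.2 (half k)) *
      zH H (star (((√(Fintype.card G : ℝ) : ℝ) : ℂ) • (delta p.1 k * rho p.2 (half k))) * a) =
      a := by
  have hG : (Fintype.card G : ℂ) ≠ 0 := Nat.cast_ne_zero.mpr Fintype.card_ne_zero
  have hs : ((√(Fintype.card G : ℝ) : ℝ) : ℂ) * ((√(Fintype.card G : ℝ) : ℝ) : ℂ) =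
      Fintype.card G := by
    rw [← Complex.ofReal_mul, Real.mul_self_sqrt (Nat.cast_nonneg _), Complex.ofReal_natCast]
  have key (p : G × H) :
      ((√(Fintype.card G : ℝ) : ℝ) : ℂ) • (delta p.1 k * rho p.2 (half k)) *
        zH H (star (((√(Fintype.card G : ℝ) : ℝ) : ℂ) • (delta p.1 k * rho p.2 (half k))) * a) =
      delta p.1 k * act p.2 1 a := by
    rw [star_smul, Complex.star_def, Complex.conj_ofReal, star_mul, star_delta, star_rho,
      smul_mul_assoc, smul_mul_assoc, map_smul, mul_smul_comm, smul_smul, hs, zH_apply, mul_smul_comm,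
      smul_inv_smul₀ hG, Finset.mul_sum, ← sum_delta_mul_rho_mul_act]
    simp only [mul_assoc]
  simp only [key]
  rw [Fintype.sum_prod_type]
  -- The inner sum over `H` reassembles `a`; the outer one is the partition of unity at site `k`.
  simp only [← Finset.mul_sum, sum_act_one, ← Finset.sum_mul, sum_delta, one_mul]

/-- The second quasi-basis identity is the first one for `a*`, starred. -/
theorem sum_zH_mul_mul_star {ι : Type*} [Fintype ι] {u : ι → FieldAlgebra H}
    (hu : ∀ a, ∑ i, u i * zH H (star (u i) * a) = a) (a : FieldAlgebra H) :
    ∑ i, zH H (a * u i) * star (u i) = a := by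
  have h := congrArg star (hu (star a))
  simpa only [star_sum, star_mul, ← zH_star, star_star] using h

end FieldAlgebra

end GSpin

end

theorem theorem3p1 {G : Type*} [Group G] [Fintype G] (H : Subgroup G) [H.Normal] [Fintype H]
    (k : ℤ) :
    GSpin.IsQuasiBasis (GSpin.FieldAlgebra.observables H)
      (GSpin.FieldAlgebra.zH H : GSpin.FieldAlgebra H →ₗ[ℂ] GSpin.FieldAlgebra H)
      (fun p : G × H => ((√(Fintype.card G : ℝ) : ℝ) : ℂ) •
        (GSpin.FieldAlgebra.delta p.1 k * GSpin.FieldAlgebra.rho p.2 (GSpin.half k))) where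
  isConditionalExpectation := GSpin.FieldAlgebra.isConditionalExpectation_zH H
  left := GSpin.FieldAlgebra.sum_mul_zH_star_mul k
  right := GSpin.FieldAlgebra.sum_zH_mul_mul_star (GSpin.FieldAlgebra.sum_mul_zH_star_mul k)
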